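/- Let $\mathbb{K}$ be an infinite field. A $\mathbb{K}$-algebra is a $\mathbb{K}$-vector space $A$ with a bilinear multiplication $A\times A\to A$, $(x,y)\mapsto xy$ (not necessarily associative or unital), and a morphism of $\mathbb{K}$-algebras is a product-preserving $\mathbb{K}$-linear map. A variety of $\mathbb{K}$-algebras is an equationally defined class of $\mathbb{K}$-algebras, that is, the class of all $\mathbb{K}$-algebras in which every member of a given set of non-associative polynomials over $\mathbb{K}$ vanishes identically; it is regarded as a full subcategory of the category of $\mathbb{K}$-algebras. A subvariety of a variety $\mathcal{W}$ is a variety contained in $\mathcal{W}$. Let $\mathsf{Alt}_{\mathbb{K}}$ be the variety of alternating algebras (those satisfying $xx=0$), $\mathsf{AAAlg}_{\mathbb{K}}$ the variety of antiassociative algebras (those satisfying $x(yz)=-(xy)z$), and $\mathsf{Lie}_{\mathbb{K}}$ the variety of Lie algebras (alternating algebras satisfying $x(yz)+z(xy)+y(zx)=0$). For an object $B$ of a category $\mathcal{C}$, let $\mathsf{Pt}_B(\mathcal{C})$ be the category of points over $B$: its objects are the pairs $(x\colon X\to B,\ s\colon B\to X)$ of morphisms of $\mathcal{C}$ with $x\circ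 s=1_B$, and a morphism $(x,s)\to(y\colon Y\to B,\ t\colon B\to Y)$ is a morphism $f\colon X\to Y$ of $\mathcal{C}$ with $y\circ f=x$ and $f\circ s=t$. If $\mathcal{C}$ has finite limits, each morphism $a\colon A\to B$ induces, by pulling back along $a$, a change-of-base functor $a^*\colon\mathsf{Pt}_B(\mathcal{C})\to\mathsf{Pt}_A(\mathcal{C})$. A pair of arrows $f\colon X\to Z$, $g\colon Y\to Z$ is jointly strongly epimorphic if it is jointly epimorphic and if, for every monomorphism $m\colon M\to N$ and all $p\colon X\to M$, $q\colon Y\to M$, $w\colon Z\to N$ with $m\circ p=w\circ f$ and $m\circ q=w\circ g$, there is $d\colon Z\to M$ with $m\circ d=w$ (and hence $d\circ f=p$ and $d\circ g=q$). A category $\mathcal{C}$ with finite limits is algebraically coherent if for every morphism $a$ of $\mathcal{C}$ the functor $a^*$ preserves jointly strongly epimorphic pairs. Theorem. Let $\mathcal{V}$ be a subvariety of $\mathsf{Alt}_{\mathbb{K}}$. Then the following are equivalent: (i) $\mathcal{V}$ is algebraically coherent; (ii) $\mathcal{V}$ is a subvariety of $\mathsf{AAAlg}_{\mathbb{K}}$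 or a subvariety of $\mathsf{Lie}_{\mathbb{K}}$. -/

import Mathlib

open CategoryTheory CategoryTheory.Limits

universe v u

/-! ### Categories of points and algebraic coherence -/

/-- A point over `B`: a split epimorphism `proj : pt ⟶ B` with a chosen section `sec`. -/
structure PointOver {C : Type u} [Category.{v} C] (B : C) where
  pt : C
  proj : pt ⟶ B
  sec : B ⟶ pt
  sec_proj : sec ≫ proj = 𝟙 B

attribute [simp] PointOver.sec_proj

namespace PointOver

/-- A morphism of points over `B`: it commutes with the projections and with the sections. -/
@[ext]
structure Hom {C : Type u} [Category.{v} C] {B : C} (P Q : PointOver B) where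
  hom : P.pt ⟶ Q.pt
  hom_proj : hom ≫ Q.proj = P.proj
  sec_hom : P.sec ≫ hom = Q.sec

attribute [simp] Hom.hom_proj Hom.sec_hom

/-- The category of points over `B`. -/
instance category {C : Type u} [Category.{v} C] (B : C) : Category.{v} (PointOver B) where
  Hom P Q := Hom P Q
  id P := ⟨𝟙 P.pt, by simp, by simp⟩
  comp f g := ⟨f.hom ≫ g.hom, by simp, by rw [← Category.assoc, f.sec_hom, g.sec_hom]⟩
  id_comp f := Hom.ext (Category.id_comp f.hom)
  comp_id f := Hom.ext (Category.comp_id f.hom)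
  assoc f g h := Hom.ext (Category.assoc f.hom g.hom h.hom)

/-- The pullback of a point over `B` along `a : A ⟶ B`, a point over `A`. -/
noncomputable abbrev pullbackObj {C : Type u} [Category.{v} C] [HasPullbacks C] {A B : C}
    (a : A ⟶ B) (P : PointOver B) : PointOver A where
  pt := pullback P.proj a
  proj := pullback.snd P.proj a
  sec := pullback.lift (a ≫ P.sec) (𝟙 A) (by
    rw [Category.assoc, P.sec_proj, Category.comp_id, Category.id_comp])
  sec_proj := pullback.lift_snd _ _ _

/-- The action of pulling back along `a : A ⟶ B` on morphisms of points. -/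
noncomputable abbrev pullbackMap {C : Type u} [Category.{v} C] [HasPullbacks C] {A B : C}
    (a : A ⟶ B) {P Q : PointOver B} (f : Hom P Q) :
    Hom (pullbackObj a P) (pullbackObj a Q) where
  hom := pullback.lift (pullback.fst P.proj a ≫ f.hom) (pullback.snd P.proj a)
    (by rw [Category.assoc, f.hom_proj, pullback.condition])
  hom_proj := pullback.lift_snd _ _ _
  sec_hom := by
    apply pullback.hom_ext
    · rw [Category.assoc, pullback.lift_fst, pullback.lift_fst_assoc, pullback.lift_fst,
        Category.assoc, f.sec_hom]
    · rw [Category.assoc, pullback.lift_snd, pullback.lift_snd, pullback.lift_snd]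

/-- The change-of-base functor `a^* : Pt_B(C) ⥤ Pt_A(C)`. -/
noncomputable def changeOfBase {C : Type u} [Category.{v} C] [HasPullbacks C] {A B : C}
    (a : A ⟶ B) : PointOver B ⥤ PointOver A where
  obj := pullbackObj a
  map f := pullbackMap a f
  map_id P := by
    apply Hom.ext
    apply pullback.hom_ext
    · exact (pullback.lift_fst _ _ _).trans
        ((Category.comp_id _).trans (Category.id_comp _).symm)
    · exact (pullback.lift_snd _ _ _).trans (Category.id_comp _).symm
  map_comp {P Q R} f g := by
    apply Hom.ext
    apply pullback.hom_ext
    · refine (pullback.lift_fst _ _ _).trans (Eq.symm ?_)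
      refine (Category.assoc _ _ _).trans ?_
      refine (congrArg _ (pullback.lift_fst _ _ _)).trans ?_
      refine (pullback.lift_fst_assoc _ _ _ _).trans ?_
      exact Category.assoc _ _ _
    · refine (pullback.lift_snd _ _ _).trans (Eq.symm ?_)
      refine (Category.assoc _ _ _).trans ?_
      exact (congrArg _ (pullback.lift_snd _ _ _)).trans (pullback.lift_snd _ _ _)

end PointOver

/-- A pair of arrows `f : X ⟶ Z`, `g : Y ⟶ Z` is jointly strongly epimorphic when it is jointly
epimorphic and has the (joint) left lifting property with respect to all monomorphisms. The
two compatibilities `f ≫ d = p` and `g ≫ d = q` of a diagonal `d` follow from `d ≫ m = w`, since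
`m` is a monomorphism. -/
structure JointlyStronglyEpi {C : Type u} [Category.{v} C] {X Y Z : C}
    (f : X ⟶ Z) (g : Y ⟶ Z) : Prop where
  jointlyEpi : ∀ ⦃W : C⦄ (h k : Z ⟶ W), f ≫ h = f ≫ k → g ≫ h = g ≫ k → h = k
  exists_lift : ∀ ⦃M N : C⦄ (m : M ⟶ N) [Mono m] (p : X ⟶ M) (q : Y ⟶ M) (w : Z ⟶ N),
    p ≫ m = f ≫ w → q ≫ m = g ≫ w → ∃ d : Z ⟶ M, d ≫ m = w

/-- A category is algebraically coherent when it has finite limits and all change-of-base functors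
between its categories of points preserve jointly strongly epimorphic pairs of arrows. -/
def AlgebraicallyCoherent (C : Type u) [Category.{v} C] : Prop :=
  ∃ _ : HasFiniteLimits C,
    ∀ ⦃A B : C⦄ (a : A ⟶ B) ⦃P Q R : PointOver B⦄ (f : P ⟶ R) (g : Q ⟶ R),
      JointlyStronglyEpi f g →
        JointlyStronglyEpi ((PointOver.changeOfBase a).map f) ((PointOver.changeOfBase a).map g)

/-! ### Non-associative algebras and their varieties -/

/-- A (not necessarily associative or unital) algebra over `K`: a `K`-module with a bilinear
multiplication. -/
structure NonAssocAlgCat (K : Type u) [Field K] where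
  carrier : Type u
  [isRing : NonUnitalNonAssocRing carrier]
  [isModule : Module K carrier]
  [isScalarTower : IsScalarTower K carrier carrier]
  [smulCommClass : SMulCommClass K carrier carrier]

namespace NonAssocAlgCat

attribute [instance] isRing isModule isScalarTower smulCommClass

instance (K : Type u) [Field K] : CoeSort (NonAssocAlgCat K) (Type u) := ⟨carrier⟩

/-- Morphisms of algebras: product-preserving linear maps. -/
@[ext]
structure Hom {K : Type u} [Field K] (A B : NonAssocAlgCat K) where
  toAlgHom : A →ₙₐ[K] B

/-- The category `Alg_K` of algebras over `K`. -/
instance category (K : Type u) [Field K] : Category.{u} (NonAssocAlgCat K) where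
  Hom A B := Hom A B
  id A := ⟨NonUnitalAlgHom.id K A⟩
  comp f g := ⟨g.toAlgHom.comp f.toAlgHom⟩

/-- The polynomial `φ` in countably many variables gives rise to a law `φ = 0` of the algebra `A`:
it vanishes under every substitution of elements of `A` for the variables. -/
def SatisfiesLaw {K : Type u} [Field K] (A : NonAssocAlgCat K)
    (φ : FreeNonUnitalNonAssocAlgebra K ℕ) : Prop :=
  ∀ x : ℕ → A, FreeNonUnitalNonAssocAlgebra.lift K x φ = 0

/-- A variety of algebras is an equationally defined class of algebras. -/
def IsVariety {K : Type u} [Field K] (V : ObjectProperty (NonAssocAlgCat K)) : Prop :=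
  ∃ E : Set (FreeNonUnitalNonAssocAlgebra K ℕ),
    ∀ A : NonAssocAlgCat K, V A ↔ ∀ φ ∈ E, A.SatisfiesLaw φ

/-- `V` is a subvariety of `W`: an equationally defined class contained in `W`. -/
def IsSubvariety {K : Type u} [Field K] (V W : ObjectProperty (NonAssocAlgCat K)) : Prop :=
  IsVariety V ∧ V ≤ W

/-- Alternating algebras: `xx = 0`. -/
def Alt (K : Type u) [Field K] : ObjectProperty (NonAssocAlgCat K) :=
  fun A => ∀ x : A, x * x = 0

/-- Antiassociative algebras: `x(yz) = -(xy)z`. -/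
def AAAlg (K : Type u) [Field K] : ObjectProperty (NonAssocAlgCat K) :=
  fun A => ∀ x y z : A, x * (y * z) = -((x * y) * z)

/-- Lie algebras: alternating algebras satisfying the Jacobi identity. -/
def Lie (K : Type u) [Field K] : ObjectProperty (NonAssocAlgCat K) :=
  fun A => (∀ x : A, x * x = 0) ∧
    ∀ x y z : A, x * (y * z) + z * (x * y) + y * (z * x) = 0

end NonAssocAlgCat

/-! Both conditions are equivalent to a single one: for some scalars `l`, `m`, every algebra of the
variety satisfies z(xy) = l·y(zx) + m·x(yz) (`HasLaw`).

The law implies coherence. In a variety, a pair of points is jointly strongly epimorphic exactly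
when the two images generate the codomain R. Let S be the subalgebra generated by the images of the
two kernels. The law moves a factor z = s(b) past a product xy onto x and y separately, so S is
stable under multiplication by the section (`sec_mul_mem_jointKerRange`). If the images generate R,
then S is the whole kernel of R. Kernels survive base change, so the pulled-back pair generates as
well.

Coherence implies the law. Take the free algebra F(x, y, z) over F(z), generated by its subpoints
F(x, z) and F(y, z), and change base along 0 → F(z). The kernel element z(xy) must then be a
combination of products of elements of the kernels of F(x, z) → F(z) and F(y, z) → F(z). Its part
linear in each variable can only involve y(zx) and x(yz). That part is read off after substituting
ε₁x, ε₂y, ε₃z, with each εᵢ² = 0. The substitution stays in the variety because A[ε] does when the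
field is infinite (`IsVariety.dual`).

Finally, anticommutativity and permutations of the variables reduce any such law to the Jacobi
identity or to antiassociativity (`HasLaw.le_AAAlg_or_le_Lie`). -/

namespace NonAssocAlgCat

variable {K : Type u} [Field K] {V : ObjectProperty (NonAssocAlgCat K)}

/-! ### Closure properties of varieties -/

/-- The bundled algebra on a type carrying an algebra structure. -/
abbrev of (K : Type u) [Field K] (A : Type u) [NonUnitalNonAssocRing A] [Module K A]
    [IsScalarTower K A A] [SMulCommClass K A A] : NonAssocAlgCat K where
  carrier := A

theorem map_lift {X A B : Type*} [NonUnitalNonAssocRing A] [Module K A]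
    [IsScalarTower K A A] [SMulCommClass K A A] [NonUnitalNonAssocRing B] [Module K B]
    [IsScalarTower K B B] [SMulCommClass K B B] (f : A →ₙₐ[K] B) (x : X → A)
    (φ : FreeNonUnitalNonAssocAlgebra K X) :
    f (FreeNonUnitalNonAssocAlgebra.lift K x φ) =
      FreeNonUnitalNonAssocAlgebra.lift K (fun i => f (x i)) φ := by
  have : f.comp (FreeNonUnitalNonAssocAlgebra.lift K x) =
      FreeNonUnitalNonAssocAlgebra.lift K (fun i => f (x i)) := by
    apply FreeNonUnitalNonAssocAlgebra.hom_ext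
    intro i
    simp
  exact DFunLike.congr_fun this φ

/-- An algebra with a separating family of morphisms into members of a variety is a member. -/
theorem IsVariety.of_separating (hV : IsVariety V) {A : NonAssocAlgCat K} {ι : Type*}
    (B : ι → NonAssocAlgCat K) (hB : ∀ i, V (B i)) (f : ∀ i, A →ₙₐ[K] B i)
    (hf : ∀ a : A, (∀ i, f i a = 0) → a = 0) : V A := by
  obtain ⟨E, hE⟩ := hV
  rw [hE]
  intro φ hφ x
  apply hf
  intro i
  rw [map_lift]
  exact (hE _).1 (hB i) φ hφ _

theorem IsVariety.of_injective (hV : IsVariety V) {A B : NonAssocAlgCat K} (hB : V B)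
    (f : A →ₙₐ[K] B) (hf : Function.Injective f) : V A :=
  hV.of_separating (fun _ : Unit => B) (fun _ => hB) (fun _ => f)
    fun _ h => hf ((h ()).trans (map_zero f).symm)

theorem IsVariety.subalgebra (hV : IsVariety V) {A : NonAssocAlgCat K} (hA : V A)
    (S : NonUnitalSubalgebra K A) : V (of K S) :=
  hV.of_injective hA (NonUnitalSubalgebraClass.subtype S) Subtype.val_injective

theorem IsVariety.prod (hV : IsVariety V) {A B : NonAssocAlgCat K} (hA : V A) (hB : V B) :
    V (of K (A × B)) :=
  hV.of_separating (fun b : Bool => bif b then A else B) (by rintro (_ | _) <;> assumption)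
    (fun b => match b with
      | true => NonUnitalAlgHom.fst K A B
      | false => NonUnitalAlgHom.snd K A B)
    fun a h => Prod.ext (h true) (h false)

theorem IsVariety.punit (hV : IsVariety V) : V (of K PUnit.{u + 1}) :=
  hV.of_separating (fun e : Empty => e.elim) (fun e => e.elim) (fun e => e.elim)
    fun _ _ => rfl

/-! ### Morphisms of a full subcategory of algebras -/

/-- The underlying algebra morphism. -/
abbrev fn {X Y : V.FullSubcategory} (f : X ⟶ Y) : X.obj →ₙₐ[K] Y.obj := f.hom.toAlgHom

/-- The morphism of the full subcategory with a given underlying algebra morphism. -/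
abbrev ofFn {X Y : V.FullSubcategory} (f : X.obj →ₙₐ[K] Y.obj) : X ⟶ Y :=
  ObjectProperty.homMk ⟨f⟩

theorem fn_injective {X Y : V.FullSubcategory} {f g : X ⟶ Y} (h : ∀ x, fn f x = fn g x) :
    f = g :=
  ObjectProperty.hom_ext _ (Hom.ext (NonUnitalAlgHom.ext h))

theorem fn_comp {X Y Z : V.FullSubcategory} (f : X ⟶ Y) (g : Y ⟶ Z) (x : X.obj) :
    fn (f ≫ g) x = fn g (fn f x) := rfl

theorem fn_congr {X Y : V.FullSubcategory} {f g : X ⟶ Y} (h : f = g) (x : X.obj) :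
    fn f x = fn g x := by rw [h]

/-! ### Pullbacks -/

/-- The subalgebra of pairs on which two morphisms agree. -/
def fiberProduct {A B C : NonAssocAlgCat K} (f : A →ₙₐ[K] C) (g : B →ₙₐ[K] C) :
    NonUnitalSubalgebra K (A × B) where
  carrier := {p | f p.1 = g p.2}
  add_mem' {p q} hp hq := by
    simp only [Set.mem_ofPred_eq] at hp hq
    simp [hp, hq]
  zero_mem' := by simp
  mul_mem' {p q} hp hq := by
    simp only [Set.mem_ofPred_eq] at hp hq
    simp [hp, hq]
  smul_mem' c p hp := by
    simp only [Set.mem_ofPred_eq] at hp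
    simp [hp]

/-- The fibre product as an object of a variety. -/
abbrev fiberProductObj (hV : IsVariety V) {X Y Z : V.FullSubcategory} (f : X ⟶ Z) (g : Y ⟶ Z) :
    V.FullSubcategory :=
  ⟨of K (fiberProduct (fn f) (fn g)), hV.subalgebra (hV.prod X.2 Y.2) _⟩

/-- The first projection of the fibre product. -/
abbrev fiberProductFst (hV : IsVariety V) {X Y Z : V.FullSubcategory} (f : X ⟶ Z) (g : Y ⟶ Z) :
    fiberProductObj hV f g ⟶ X :=
  ofFn ((NonUnitalAlgHom.fst K X.obj Y.obj).comp
    (NonUnitalSubalgebraClass.subtype (fiberProduct (fn f) (fn g))))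

/-- The second projection of the fibre product. -/
abbrev fiberProductSnd (hV : IsVariety V) {X Y Z : V.FullSubcategory} (f : X ⟶ Z) (g : Y ⟶ Z) :
    fiberProductObj hV f g ⟶ Y :=
  ofFn ((NonUnitalAlgHom.snd K X.obj Y.obj).comp
    (NonUnitalSubalgebraClass.subtype (fiberProduct (fn f) (fn g))))

/-- The morphism into the fibre product induced by a commutative square. -/
abbrev fiberProductLift (hV : IsVariety V) {W X Y Z : V.FullSubcategory} (f : X ⟶ Z) (g : Y ⟶ Z)
    (p : W ⟶ X) (q : W ⟶ Y) (h : p ≫ f = q ≫ g) : W ⟶ fiberProductObj hV f g :=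
  ofFn (NonUnitalAlgHom.codRestrict ((fn p).prod (fn q)) (fiberProduct (fn f) (fn g))
    fun w => fn_congr h w)

theorem fiberProduct_condition (hV : IsVariety V) {X Y Z : V.FullSubcategory} (f : X ⟶ Z)
    (g : Y ⟶ Z) : fiberProductFst hV f g ≫ f = fiberProductSnd hV f g ≫ g :=
  fn_injective fun x => x.2

/-- The fibre product is a pullback. -/
noncomputable def fiberProductIsLimit (hV : IsVariety V) {X Y Z : V.FullSubcategory} (f : X ⟶ Z)
    (g : Y ⟶ Z) : IsLimit (PullbackCone.mk _ _ (fiberProduct_condition hV f g)) :=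
  PullbackCone.IsLimit.mk _
    (fun s => fiberProductLift hV f g s.fst s.snd s.condition)
    (fun _ => fn_injective fun _ => rfl) (fun _ => fn_injective fun _ => rfl)
    (fun _ _ h₁ h₂ => fn_injective fun x => Subtype.ext
      (Prod.ext (fn_congr h₁ x) (fn_congr h₂ x)))

theorem IsVariety.hasPullbacks (hV : IsVariety V) : HasPullbacks V.FullSubcategory :=
  have {X Y Z : V.FullSubcategory} {f : X ⟶ Z} {g : Y ⟶ Z} : HasLimit (cospan f g) :=
    ⟨⟨⟨_, fiberProductIsLimit hV f g⟩⟩⟩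
  hasPullbacks_of_hasLimit_cospan _

/-- The zero algebra as an object of a variety. -/
abbrev zeroObj (hV : IsVariety V) : V.FullSubcategory := ⟨of K PUnit.{u + 1}, hV.punit⟩

theorem IsVariety.hasFiniteLimits (hV : IsVariety V) : HasFiniteLimits V.FullSubcategory := by
  have := hV.hasPullbacks
  have : HasTerminal V.FullSubcategory :=
    (IsTerminal.ofUniqueHom (Y := zeroObj hV)
      (fun X => ofFn (X := X) (Y := zeroObj hV) 0)
      (fun X f => fn_injective fun x => rfl)).hasTerminal
  exact hasFiniteLimits_of_hasTerminal_and_pullbacks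

section pullback

variable [HasPullbacks V.FullSubcategory] {X Y Z : V.FullSubcategory} {f : X ⟶ Z} {g : Y ⟶ Z}

/-- The chosen pullback has no prescribed elements. Comparison with the explicit fibre product lets
it be treated as a set of pairs. -/
theorem pullback_exists (hV : IsVariety V) (x : X.obj) (y : Y.obj) (h : fn f x = fn g y) :
    ∃ w : (pullback f g).obj, fn (pullback.fst f g) w = x ∧ fn (pullback.snd f g) w = y := by
  let l : fiberProductObj hV f g ⟶ pullback f g :=
    pullback.lift _ _ (fiberProduct_condition hV f g)
  let p : (fiberProductObj hV f g).obj := ⟨(x, y), h⟩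
  exact ⟨fn l p, fn_congr (pullback.lift_fst _ _ (fiberProduct_condition hV f g)) p,
    fn_congr (pullback.lift_snd _ _ (fiberProduct_condition hV f g)) p⟩

theorem pullback_ext (hV : IsVariety V) {v w : (pullback f g).obj}
    (h₁ : fn (pullback.fst f g) v = fn (pullback.fst f g) w)
    (h₂ : fn (pullback.snd f g) v = fn (pullback.snd f g) w) : v = w := by
  let l : fiberProductObj hV f g ⟶ pullback f g :=
    pullback.lift _ _ (fiberProduct_condition hV f g)
  let m : pullback f g ⟶ fiberProductObj hV f g :=
    fiberProductLift hV f g _ _ pullback.condition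
  have hml : m ≫ l = 𝟙 _ := by
    apply pullback.hom_ext
    · rw [Category.assoc, pullback.lift_fst, Category.id_comp]
      exact fn_injective fun _ => rfl
    · rw [Category.assoc, pullback.lift_snd, Category.id_comp]
      exact fn_injective fun _ => rfl
  have hm : fn m v = fn m w := Subtype.ext (Prod.ext h₁ h₂)
  calc v = fn (m ≫ l) v := (fn_congr hml v).symm
    _ = fn (m ≫ l) w := congrArg (fn l) hm
    _ = w := fn_congr hml w

end pullback

/-! ### Jointly strongly epimorphic pairs of points -/

variable {B : V.FullSubcategory} {P Q R : PointOver B}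

/-- The subalgebra generated by the images of two morphisms of points. -/
abbrev jointRange (f : P ⟶ R) (g : Q ⟶ R) : NonUnitalSubalgebra K R.pt.obj :=
  NonUnitalAlgebra.adjoin K (Set.range (fn f.hom) ∪ Set.range (fn g.hom))

theorem mem_jointRange_left (f : P ⟶ R) (g : Q ⟶ R) (p : P.pt.obj) :
    fn f.hom p ∈ jointRange f g :=
  NonUnitalAlgebra.subset_adjoin K (Or.inl ⟨p, rfl⟩)

theorem mem_jointRange_right (f : P ⟶ R) (g : Q ⟶ R) (q : Q.pt.obj) :
    fn g.hom q ∈ jointRange f g :=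
  NonUnitalAlgebra.subset_adjoin K (Or.inr ⟨q, rfl⟩)

/-- The generated subalgebra contains the section of `R`, so it is itself a point and its inclusion
a monomorphism of points. Lifting the identity of `R` through this inclusion shows that it is
everything. -/
theorem jointRange_eq_top (hV : IsVariety V) {f : P ⟶ R} {g : Q ⟶ R}
    (h : JointlyStronglyEpi f g) : jointRange f g = ⊤ := by
  let S := jointRange f g
  let SO : V.FullSubcategory := ⟨of K S, hV.subalgebra R.pt.2 S⟩
  let inc : SO ⟶ R.pt := ofFn (NonUnitalSubalgebraClass.subtype S)
  let M : PointOver B :=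
    { pt := SO
      proj := inc ≫ R.proj
      sec := ofFn (NonUnitalAlgHom.codRestrict (fn R.sec) S fun b => by
        have := mem_jointRange_left f g (fn P.sec b)
        rwa [← fn_comp, f.sec_hom] at this)
      sec_proj := fn_injective fun b => fn_congr R.sec_proj b }
  let m : M ⟶ R := ⟨inc, rfl, fn_injective fun b => rfl⟩
  have : Mono m := ⟨fun k l hkl => PointOver.Hom.ext (fn_injective fun x =>
    Subtype.ext (fn_congr (congrArg PointOver.Hom.hom hkl) x))⟩
  let p : P ⟶ M :=
    ⟨ofFn (NonUnitalAlgHom.codRestrict (fn f.hom) S (mem_jointRange_left f g)),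
      fn_injective fun x => fn_congr f.hom_proj x,
      fn_injective fun b => Subtype.ext (fn_congr f.sec_hom b)⟩
  let q : Q ⟶ M :=
    ⟨ofFn (NonUnitalAlgHom.codRestrict (fn g.hom) S (mem_jointRange_right f g)),
      fn_injective fun x => fn_congr g.hom_proj x,
      fn_injective fun b => Subtype.ext (fn_congr g.sec_hom b)⟩
  obtain ⟨d, hd⟩ := h.exists_lift m p q (𝟙 R)
    (PointOver.Hom.ext (fn_injective fun _ => rfl)) (PointOver.Hom.ext (fn_injective fun _ => rfl))
  rw [eq_top_iff]
  intro r _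
  have hr : ((fn d.hom r : S) : R.pt.obj) = r := fn_congr (congrArg PointOver.Hom.hom hd) r
  rw [← hr]
  exact (fn d.hom r : S).2

/-- The kernel pair of `f` is again a point over `B`, so its two projections may be cancelled
against `f`. -/
theorem injective_of_mono (hV : IsVariety V) (f : P ⟶ R) [Mono f] :
    Function.Injective (fn f.hom) := by
  let E : PointOver B :=
    { pt := fiberProductObj hV f.hom f.hom
      proj := fiberProductFst hV f.hom f.hom ≫ P.proj
      sec := fiberProductLift hV f.hom f.hom P.sec P.sec rfl
      sec_proj := fn_injective fun b => fn_congr P.sec_proj b }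
  let k : E ⟶ P := ⟨fiberProductFst hV f.hom f.hom, rfl, fn_injective fun _ => rfl⟩
  let l : E ⟶ P := ⟨fiberProductSnd hV f.hom f.hom, by
    rw [← f.hom_proj, ← Category.assoc, ← fiberProduct_condition hV, Category.assoc,
      f.hom_proj], fn_injective fun _ => rfl⟩
  have hkl : k = l := by
    rw [← cancel_mono f]
    exact PointOver.Hom.ext (fiberProduct_condition hV f.hom f.hom)
  intro x y hxy
  exact fn_congr (congrArg PointOver.Hom.hom hkl) (⟨(x, y), hxy⟩ : fiberProduct _ _)

theorem jointlyStronglyEpi_of_jointRange_eq_top (hV : IsVariety V) {f : P ⟶ R} {g : Q ⟶ R}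
    (h : jointRange f g = ⊤) : JointlyStronglyEpi f g where
  jointlyEpi W k l hf hg := by
    refine PointOver.Hom.ext (fn_injective fun r => ?_)
    have hr : r ∈ jointRange f g := h ▸ NonUnitalAlgebra.mem_top
    induction hr using NonUnitalAlgebra.adjoin_induction with
    | mem x hx =>
      rcases hx with ⟨p, rfl⟩ | ⟨q, rfl⟩
      · exact fn_congr (congrArg PointOver.Hom.hom hf) p
      · exact fn_congr (congrArg PointOver.Hom.hom hg) q
    | add x y _ _ hx hy => rw [map_add, map_add, hx, hy]
    | zero => rw [map_zero, map_zero]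
    | mul x y _ _ hx hy => rw [map_mul, map_mul, hx, hy]
    | smul c x _ hx => rw [map_smul, map_smul, hx]
  exists_lift M N m _ p q w hp hq := by
    have hm := injective_of_mono hV m
    have key : ∀ r : R.pt.obj, ∃ y, fn m.hom y = fn w.hom r := by
      intro r
      have hr : r ∈ jointRange f g := h ▸ NonUnitalAlgebra.mem_top
      induction hr using NonUnitalAlgebra.adjoin_induction with
      | mem x hx =>
        rcases hx with ⟨a, rfl⟩ | ⟨a, rfl⟩
        · exact ⟨_, fn_congr (congrArg PointOver.Hom.hom hp) a⟩
        · exact ⟨_, fn_congr (congrArg PointOver.Hom.hom hq) a⟩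
      | add x y _ _ hx hy =>
        obtain ⟨⟨a, ha⟩, b, hb⟩ := And.intro hx hy
        exact ⟨a + b, by rw [map_add, map_add, ha, hb]⟩
      | zero => exact ⟨0, by rw [map_zero, map_zero]⟩
      | mul x y _ _ hx hy =>
        obtain ⟨⟨a, ha⟩, b, hb⟩ := And.intro hx hy
        exact ⟨a * b, by rw [map_mul, map_mul, ha, hb]⟩
      | smul c x _ hx =>
        obtain ⟨a, ha⟩ := hx
        exact ⟨c • a, by rw [map_smul, map_smul, ha]⟩
    -- Injectivity of `m` makes these preimages unique, so `d` is automatically an algebra morphism.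
    choose d hd using key
    let D : R.pt.obj →ₙₐ[K] M.pt.obj :=
      { toFun := d
        map_smul' := fun c x => hm (by rw [hd, map_smul, MonoidHom.id_apply, map_smul, hd])
        map_zero' := hm (by rw [hd, map_zero, map_zero])
        map_add' := fun x y => hm (by rw [hd, map_add, map_add, hd, hd])
        map_mul' := fun x y => hm (by rw [hd, map_mul, map_mul, hd, hd]) }
    have hD : ofFn D ≫ m.hom = w.hom := fn_injective hd
    refine ⟨⟨ofFn D, ?_, ?_⟩, PointOver.Hom.ext hD⟩
    · rw [← m.hom_proj, ← Category.assoc, hD, w.hom_proj]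
    · refine fn_injective fun b => hm ?_
      rw [← fn_comp, Category.assoc, hD, w.sec_hom, ← fn_comp, m.sec_hom]

end NonAssocAlgCat

namespace NonAssocAlgCat

variable {K : Type u} [Field K] {V : ObjectProperty (NonAssocAlgCat K)}

/-! ### Coherence from a law expressing `z(xy)` through `y(zx)` and `x(yz)` -/

/-- Every algebra in `V` satisfies `z(xy) = l • y(zx) + m • x(yz)`. -/
def HasLaw (V : ObjectProperty (NonAssocAlgCat K)) (l m : K) : Prop :=
  ∀ A : NonAssocAlgCat K, V A → ∀ x y z : A, z * (x * y) = l • (y * (z * x)) + m • (x * (y * z))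

theorem mul_eq_neg {A : NonAssocAlgCat K} (hA : Alt K A) (x y : A) : x * y = -(y * x) := by
  have h := hA (x + y)
  rw [add_mul, mul_add, mul_add, hA x, hA y, zero_add, add_zero] at h
  exact eq_neg_of_add_eq_zero_left h

section kernel

variable {B : V.FullSubcategory} {P Q R : PointOver B} (f : P ⟶ R) (g : Q ⟶ R)

/-- The subalgebra generated by the images of the kernels of two points. -/
abbrev jointKerRange : NonUnitalSubalgebra K R.pt.obj :=
  NonUnitalAlgebra.adjoin K
    ({x | ∃ p, fn P.proj p = 0 ∧ fn f.hom p = x} ∪ {x | ∃ q, fn Q.proj q = 0 ∧ fn g.hom q = x})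

variable {f g}

/-- Kernels are ideals, which settles the generators. On a product xy the law replaces s(b)(xy) by
multiples of y(s(b)x) and x(y s(b)), to which the induction hypotheses apply. -/
theorem sec_mul_mem_jointKerRange (hAlt : V ≤ Alt K) {l m : K} (hlaw : HasLaw V l m)
    (b : B.obj) {k : R.pt.obj} (hk : k ∈ jointKerRange f g) :
    fn R.sec b * k ∈ jointKerRange f g := by
  induction hk using NonUnitalAlgebra.adjoin_induction with
  | mem x hx =>
    apply NonUnitalAlgebra.subset_adjoin
    rcases hx with ⟨p, hp, rfl⟩ | ⟨q, hq, rfl⟩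
    · refine Or.inl ⟨fn P.sec b * p, ?_, ?_⟩
      · rw [map_mul, hp, mul_zero]
      · rw [map_mul, ← fn_comp, f.sec_hom]
    · refine Or.inr ⟨fn Q.sec b * q, ?_, ?_⟩
      · rw [map_mul, hq, mul_zero]
      · rw [map_mul, ← fn_comp, g.sec_hom]
  | add x y _ _ hx hy => rw [mul_add]; exact add_mem hx hy
  | zero => rw [mul_zero]; exact zero_mem _
  | mul x y hx' hy' hx hy =>
    rw [hlaw _ R.pt.2 x y, mul_eq_neg (hAlt _ R.pt.2) y (fn R.sec b)]
    exact add_mem (SMulMemClass.smul_mem _ (mul_mem hy' hx))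
      (SMulMemClass.smul_mem _ (mul_mem hx' (neg_mem hy)))
  | smul c x _ hx => rw [mul_smul_comm]; exact SMulMemClass.smul_mem _ hx

theorem sub_sec_proj_mem_jointKerRange (hAlt : V ≤ Alt K) {l m : K} (hlaw : HasLaw V l m)
    (h : jointRange f g = ⊤) (r : R.pt.obj) :
    r - fn R.sec (fn R.proj r) ∈ jointKerRange f g := by
  have hr : r ∈ jointRange f g := h ▸ NonUnitalAlgebra.mem_top
  induction hr using NonUnitalAlgebra.adjoin_induction with
  | mem x hx =>
    apply NonUnitalAlgebra.subset_adjoin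
    rcases hx with ⟨p, rfl⟩ | ⟨q, rfl⟩
    · refine Or.inl ⟨p - fn P.sec (fn P.proj p), ?_, ?_⟩
      · rw [map_sub, sub_eq_zero]
        exact (fn_congr P.sec_proj _).symm
      · rw [map_sub, ← fn_comp P.sec, f.sec_hom, ← fn_comp f.hom, f.hom_proj]
    · refine Or.inr ⟨q - fn Q.sec (fn Q.proj q), ?_, ?_⟩
      · rw [map_sub, sub_eq_zero]
        exact (fn_congr Q.sec_proj _).symm
      · rw [map_sub, ← fn_comp Q.sec, g.sec_hom, ← fn_comp g.hom, g.hom_proj]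
  | add x y _ _ hx hy =>
    rw [map_add, map_add, add_sub_add_comm]
    exact add_mem hx hy
  | zero => rw [map_zero, map_zero, sub_zero]; exact zero_mem _
  | mul x y _ _ hx hy =>
    set s := fn R.sec (fn R.proj x)
    set t := fn R.sec (fn R.proj y)
    -- Write x = s + x' and y = t + y' with x', y' in the kernel: beyond st, the product consists of
    -- x'y' and two terms in which the section acts.
    have e : x * y - fn R.sec (fn R.proj (x * y)) =
        (x - s) * (y - t) + (-(t * (x - s)) + s * (y - t)) := by
      rw [← mul_eq_neg (hAlt _ R.pt.2) (x - s) t, map_mul, map_mul]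
      change x * y - s * t = _
      simp only [mul_sub, sub_mul]
      abel
    rw [e]
    exact add_mem (mul_mem hx hy) (add_mem
      (neg_mem (sec_mul_mem_jointKerRange hAlt hlaw _ hx))
      (sec_mul_mem_jointKerRange hAlt hlaw _ hy))
  | smul c x _ hx =>
    rw [map_smul, map_smul, ← smul_sub]
    exact SMulMemClass.smul_mem _ hx

variable [HasPullbacks V.FullSubcategory] {A : V.FullSubcategory} (a : A ⟶ B)

/-- The algebra morphism underlying the change of base of a morphism of points. -/
noncomputable def changeOfBaseFn (f : P ⟶ R) :
    (pullback P.proj a).obj →ₙₐ[K] (pullback R.proj a).obj :=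
  fn ((PointOver.changeOfBase a).map f).hom

/-- The subalgebra generated by the images of the change of base of two morphisms of points. -/
noncomputable def jointRangeChangeOfBase (f : P ⟶ R) (g : Q ⟶ R) :
    NonUnitalSubalgebra K (pullback R.proj a).obj :=
  jointRange ((PointOver.changeOfBase a).map f) ((PointOver.changeOfBase a).map g)

theorem changeOfBaseFn_mem_left (f : P ⟶ R) (g : Q ⟶ R) (p : (pullback P.proj a).obj) :
    changeOfBaseFn a f p ∈ jointRangeChangeOfBase a f g :=
  mem_jointRange_left ((PointOver.changeOfBase a).map f) ((PointOver.changeOfBase a).map g) p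

theorem changeOfBaseFn_mem_right (f : P ⟶ R) (g : Q ⟶ R) (q : (pullback Q.proj a).obj) :
    changeOfBaseFn a g q ∈ jointRangeChangeOfBase a f g :=
  mem_jointRange_right ((PointOver.changeOfBase a).map f) ((PointOver.changeOfBase a).map g) q

theorem fst_changeOfBaseFn (p : (pullback P.proj a).obj) :
    fn (pullback.fst R.proj a) (changeOfBaseFn a f p) =
      fn f.hom (fn (pullback.fst P.proj a) p) :=
  fn_congr (pullback.lift_fst (pullback.fst P.proj a ≫ f.hom) (pullback.snd P.proj a)
    (by rw [Category.assoc, f.hom_proj, pullback.condition])) p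

theorem snd_changeOfBaseFn (p : (pullback P.proj a).obj) :
    fn (pullback.snd R.proj a) (changeOfBaseFn a f p) =
      fn (pullback.snd P.proj a) p :=
  fn_congr (pullback.lift_snd (pullback.fst P.proj a ≫ f.hom) (pullback.snd P.proj a)
    (by rw [Category.assoc, f.hom_proj, pullback.condition])) p

/-- An element p of a kernel yields (p, 0) in the pullback whatever `a` is, and such pairs are
closed under the operations. -/
theorem exists_mem_jointRange_changeOfBase (hV : IsVariety V) {k : R.pt.obj}
    (hk : k ∈ jointKerRange f g) :
    ∃ w : (pullback R.proj a).obj,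
      w ∈ jointRangeChangeOfBase a f g ∧
        fn (pullback.fst R.proj a) w = k ∧ fn (pullback.snd R.proj a) w = 0 := by
  induction hk using NonUnitalAlgebra.adjoin_induction with
  | mem x hx =>
    rcases hx with ⟨p, hp, rfl⟩ | ⟨q, hq, rfl⟩
    · obtain ⟨w, h₁, h₂⟩ := pullback_exists (f := P.proj) (g := a) hV p 0
        (by rw [map_zero]; exact hp)
      refine ⟨_, changeOfBaseFn_mem_left a f g w, ?_, ?_⟩
      · rw [fst_changeOfBaseFn, h₁]
      · rw [snd_changeOfBaseFn, h₂]
    · obtain ⟨w, h₁, h₂⟩ := pullback_exists (f := Q.proj) (g := a) hV q 0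
        (by rw [map_zero]; exact hq)
      refine ⟨_, changeOfBaseFn_mem_right a f g w, ?_, ?_⟩
      · rw [fst_changeOfBaseFn, h₁]
      · rw [snd_changeOfBaseFn, h₂]
  | add x y _ _ hx hy =>
    obtain ⟨⟨v, hv, v₁, v₂⟩, w, hw, w₁, w₂⟩ := And.intro hx hy
    exact ⟨v + w, add_mem hv hw, by rw [map_add, v₁, w₁], by rw [map_add, v₂, w₂, add_zero]⟩
  | zero => exact ⟨0, zero_mem _, map_zero _, map_zero _⟩
  | mul x y _ _ hx hy =>
    obtain ⟨⟨v, hv, v₁, v₂⟩, w, hw, w₁, w₂⟩ := And.intro hx hy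
    exact ⟨v * w, mul_mem hv hw, by rw [map_mul, v₁, w₁], by rw [map_mul, v₂, w₂, mul_zero]⟩
  | smul c x _ hx =>
    obtain ⟨v, hv, v₁, v₂⟩ := hx
    exact ⟨c • v, SMulMemClass.smul_mem _ hv, by rw [map_smul, v₁],
      by rw [map_smul, v₂, smul_zero]⟩

/-- Split a pair (r, c) as (r - s(a(c)), 0) + (s(a(c)), c). The first term comes from the kernels,
the second is already in the image of the first point. -/
theorem jointRange_changeOfBase_eq_top (hV : IsVariety V) (hAlt : V ≤ Alt K) {l m : K}
    (hlaw : HasLaw V l m) (h : jointRange f g = ⊤) :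
    jointRangeChangeOfBase a f g = ⊤ := by
  rw [eq_top_iff]
  intro w _
  obtain ⟨v, hv, v₁, v₂⟩ := exists_mem_jointRange_changeOfBase a hV
    (sub_sec_proj_mem_jointKerRange hAlt hlaw h (fn (pullback.fst R.proj a) w))
  obtain ⟨p, p₁, p₂⟩ := pullback_exists (f := P.proj) (g := a) hV
    (fn P.sec (fn a (fn (pullback.snd R.proj a) w))) (fn (pullback.snd R.proj a) w)
    (fn_congr P.sec_proj _)
  have e : w = v + changeOfBaseFn a f p := by
    apply pullback_ext hV
    · rw [map_add, v₁, fst_changeOfBaseFn, p₁, ← fn_comp P.sec, f.sec_hom,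
        show fn a (fn (pullback.snd R.proj a) w) = fn R.proj (fn (pullback.fst R.proj a) w)
          from fn_congr pullback.condition.symm w, sub_add_cancel]
    · rw [map_add, v₂, snd_changeOfBaseFn, p₂, zero_add]
  rw [e]
  exact add_mem hv (changeOfBaseFn_mem_left a f g p)

end kernel

theorem HasLaw.algebraicallyCoherent (hV : IsVariety V) (hAlt : V ≤ Alt K) {l m : K}
    (hlaw : HasLaw V l m) : AlgebraicallyCoherent V.FullSubcategory :=
  ⟨hV.hasFiniteLimits, fun _ _ a _ _ _ _ _ hfg =>
    have := hV.hasFiniteLimits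
    jointlyStronglyEpi_of_jointRange_eq_top hV
      (jointRange_changeOfBase_eq_top a hV hAlt hlaw (jointRange_eq_top hV hfg))⟩

/-! ### Which varieties satisfy such a law -/

theorem hasLaw_of_le_Lie (h : V ≤ Lie K) : HasLaw V (-1) (-1) := by
  intro A hA x y z
  have := (h A hA).2 x y z
  rw [neg_one_smul, neg_one_smul, ← sub_eq_zero, ← this]
  abel

theorem hasLaw_of_le_AAAlg (hAlt : V ≤ Alt K) (h : V ≤ AAAlg K) : HasLaw V 0 1 := by
  intro A hA x y z
  rw [zero_smul, one_smul, zero_add, h A hA x y z, mul_eq_neg (hAlt A hA)]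

/-- Exchanging x and y exchanges l and m. If l ≠ m, subtraction gives y(zx) = x(yz), which with
anticommutativity is antiassociativity. If l = m, subtracting two cyclic shifts gives the same
identity unless l = -1, which is Jacobi. -/
theorem HasLaw.le_AAAlg_or_le_Lie (hAlt : V ≤ Alt K) {l m : K} (hlaw : HasLaw V l m) :
    V ≤ AAAlg K ∨ V ≤ Lie K := by
  have cyclic : (∀ A : NonAssocAlgCat K, V A → ∀ x y z : A, y * (z * x) = x * (y * z)) →
      V ≤ AAAlg K := by
    intro h A hA x y z
    rw [← h A hA x y z, ← h A hA y z x, mul_eq_neg (hAlt A hA)]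
  have swap : ∀ A : NonAssocAlgCat K, V A → ∀ x y z : A,
      z * (x * y) = m • (y * (z * x)) + l • (x * (y * z)) := by
    intro A hA x y z
    have h := hlaw A hA y x z
    rw [mul_eq_neg (hAlt A hA) y x, mul_eq_neg (hAlt A hA) z y, mul_eq_neg (hAlt A hA) x z] at h
    simp only [mul_neg, smul_neg] at h
    rw [← neg_inj, h]
    abel
  by_cases hlm : l = m
  · subst hlm
    by_cases hl : l = -1
    · right
      intro A hA
      refine ⟨hAlt A hA, fun x y z => ?_⟩
      rw [hlaw A hA x y z, hl, neg_one_smul, neg_one_smul]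
      abel
    · left
      apply cyclic
      intro A hA x y z
      have h₁ := hlaw A hA z x y
      have h₂ := hlaw A hA y z x
      have h : (l + 1) • (y * (z * x) - x * (y * z)) = 0 := by
        rw [add_smul, one_smul, smul_sub, sub_add_sub_comm]
        nth_rw 2 [h₁]
        nth_rw 3 [h₂]
        abel
      rcases smul_eq_zero.1 h with h | h
      · exact absurd (eq_neg_of_add_eq_zero_left h) hl
      · exact sub_eq_zero.1 h
  · left
    apply cyclic
    intro A hA x y z
    have h : (l - m) • (y * (z * x) - x * (y * z)) = 0 := by
      have := (hlaw A hA x y z).symm.trans (swap A hA x y z)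
      rw [← sub_eq_zero] at this
      rw [← this, sub_smul, smul_sub, smul_sub]
      abel
    rcases smul_eq_zero.1 h with h | h
    · exact absurd (sub_eq_zero.1 h) hlm
    · exact sub_eq_zero.1 h

end NonAssocAlgCat

namespace NonAssocAlgCat

variable {K : Type u} [Field K] {V : ObjectProperty (NonAssocAlgCat K)}

theorem IsVariety.of_surjective (hV : IsVariety V) {A B : NonAssocAlgCat K} (hA : V A)
    (f : A →ₙₐ[K] B) (hf : Function.Surjective f) : V B := by
  obtain ⟨E, hE⟩ := hV
  rw [hE] at hA ⊢
  intro φ hφ x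
  choose y hy using fun i => hf (x i)
  rw [show x = fun i => f (y i) from funext fun i => (hy i).symm, ← map_lift, hA φ hφ, map_zero]

/-! ### Dual numbers over an algebra -/

/-- The algebra `A[ε]` with `ε² = 0`; the pair `(a, b)` stands for `a + εb`. -/
def Dual (A : Type u) : Type u := A × A

namespace Dual

variable {A : Type u} [NonUnitalNonAssocRing A] [Module K A]

instance : AddCommGroup (Dual A) := inferInstanceAs (AddCommGroup (A × A))
instance : Module K (Dual A) := inferInstanceAs (Module K (A × A))
instance : Mul (Dual A) := ⟨fun p q => (p.1 * q.1, p.1 * q.2 + p.2 * q.1)⟩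

@[simp] theorem fst_zero : (0 : Dual A).1 = 0 := rfl
@[simp] theorem snd_zero : (0 : Dual A).2 = 0 := rfl
@[simp] theorem fst_add (p q : Dual A) : (p + q).1 = p.1 + q.1 := rfl
@[simp] theorem snd_add (p q : Dual A) : (p + q).2 = p.2 + q.2 := rfl
@[simp] theorem fst_smul (c : K) (p : Dual A) : (c • p).1 = c • p.1 := rfl
@[simp] theorem snd_smul (c : K) (p : Dual A) : (c • p).2 = c • p.2 := rfl
@[simp] theorem fst_mul (p q : Dual A) : (p * q).1 = p.1 * q.1 := rfl
@[simp] theorem snd_mul (p q : Dual A) : (p * q).2 = p.1 * q.2 + p.2 * q.1 := rfl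

instance : NonUnitalNonAssocRing (Dual A) :=
  { (inferInstance : AddCommGroup (Dual A)), (inferInstance : Mul (Dual A)) with
    left_distrib := fun p q r => Prod.ext (mul_add _ _ _) (by simp [mul_add]; abel)
    right_distrib := fun p q r => Prod.ext (add_mul _ _ _) (by simp [add_mul]; abel)
    zero_mul := fun p => Prod.ext (zero_mul _) (by simp)
    mul_zero := fun p => Prod.ext (mul_zero _) (by simp) }

instance [IsScalarTower K A A] : IsScalarTower K (Dual A) (Dual A) :=
  ⟨fun c p q => Prod.ext (smul_mul_assoc c p.1 q.1) (by simp [smul_mul_assoc])⟩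

instance [SMulCommClass K A A] : SMulCommClass K (Dual A) (Dual A) :=
  ⟨fun c p q => Prod.ext (mul_smul_comm c p.1 q.1).symm (by simp [mul_smul_comm])⟩

end Dual

/-! ### Polynomial functions with values in an algebra -/

section polynomialFunctions

variable (K) (A : Type u) [NonUnitalNonAssocRing A] [Module K A]

/-- Polynomial functions `K → A`. -/
def polyFun : Submodule K (K → A) :=
  Submodule.span K (Set.range fun p : ℕ × A => fun t : K => t ^ p.1 • p.2)

variable {K A}

theorem monomial_mem_polyFun (i : ℕ) (a : A) : (fun t : K => t ^ i • a) ∈ polyFun K A :=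
  Submodule.subset_span ⟨(i, a), rfl⟩

theorem const_mem_polyFun (a : A) : (fun _ : K => a) ∈ polyFun K A := by
  simpa using monomial_mem_polyFun (K := K) 0 a

theorem mul_mem_polyFun [IsScalarTower K A A] [SMulCommClass K A A] {f g : K → A}
    (hf : f ∈ polyFun K A) (hg : g ∈ polyFun K A) : f * g ∈ polyFun K A := by
  induction hf using Submodule.span_induction with
  | mem x hx =>
    obtain ⟨⟨i, a⟩, rfl⟩ := hx
    induction hg using Submodule.span_induction with
    | mem y hy =>
      obtain ⟨⟨j, b⟩, rfl⟩ := hy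
      convert monomial_mem_polyFun (K := K) (i + j) (a * b) using 1
      funext t
      simp [smul_mul_assoc, mul_smul_comm, smul_smul, pow_add, mul_comm]
    | zero => rw [mul_zero]; exact zero_mem _
    | add x y _ _ hx hy => rw [mul_add]; exact add_mem hx hy
    | smul c x _ hx => rw [mul_smul_comm]; exact Submodule.smul_mem _ _ hx
  | zero => rw [zero_mul]; exact zero_mem _
  | add x y _ _ hx hy => rw [add_mul]; exact add_mem hx hy
  | smul c x _ hx => rw [smul_mul_assoc]; exact Submodule.smul_mem _ _ hx

theorem id_smul_mem_polyFun {f : K → A} (hf : f ∈ polyFun K A) :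
    (fun t => t • f t) ∈ polyFun K A := by
  induction hf using Submodule.span_induction with
  | mem x hx =>
    obtain ⟨⟨i, a⟩, rfl⟩ := hx
    convert monomial_mem_polyFun (K := K) (i + 1) a using 1
    funext t
    simp [smul_smul, pow_succ']
  | zero => simp only [Pi.zero_apply, smul_zero]; exact zero_mem _
  | add x y _ _ hx hy => simpa [Pi.add_def] using add_mem hx hy
  | smul c x _ hx =>
    convert Submodule.smul_mem _ c hx using 1
    funext t
    simp [smul_comm t c]

theorem exists_polynomial_of_mem_polyFun {f : K → A} (hf : f ∈ polyFun K A)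
    (L : A →ₗ[K] K) : ∃ p : Polynomial K, ∀ t, L (f t) = p.eval t := by
  induction hf using Submodule.span_induction with
  | mem x hx =>
    obtain ⟨⟨i, a⟩, rfl⟩ := hx
    exact ⟨Polynomial.C (L a) * Polynomial.X ^ i, fun t => by simpa using mul_comm _ _⟩
  | zero => exact ⟨0, by simp⟩
  | add x y _ _ hx hy =>
    obtain ⟨⟨p, hp⟩, q, hq⟩ := And.intro hx hy
    exact ⟨p + q, fun t => by simp [hp, hq]⟩
  | smul c x _ hx =>
    obtain ⟨p, hp⟩ := hx
    exact ⟨Polynomial.C c * p, fun t => by simp [hp]⟩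

/-- A polynomial function over an infinite field that vanishes off `0` vanishes at `0`. -/
theorem polyFun_apply_zero [Infinite K] {f : K → A} (hf : f ∈ polyFun K A)
    (h : ∀ t, t • f t = 0) : f 0 = 0 := by
  -- Linear functionals separate vectors, so it suffices to treat scalar polynomials.
  refine (Module.forall_dual_apply_eq_zero_iff K (f 0)).1 fun L => ?_
  obtain ⟨p, hp⟩ := exists_polynomial_of_mem_polyFun hf L
  have : Polynomial.X * p = 0 := Polynomial.funext fun t => by
    rw [Polynomial.eval_mul, Polynomial.eval_X, ← hp, ← smul_eq_mul, ← map_smul, h, map_zero,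
      Polynomial.eval_zero]
  rw [hp, (mul_eq_zero.1 this).resolve_left Polynomial.X_ne_zero, Polynomial.eval_zero]

end polynomialFunctions

/-! ### Closure of a variety under dual numbers -/

section dualClosure

variable {A : Type u} [NonUnitalNonAssocRing A] [Module K A]
  [IsScalarTower K A A] [SMulCommClass K A A]

variable (K A) in
/-- Polynomial functions `K → A` together with their first-order jets at `0`. -/
def jets : NonUnitalSubalgebra K ((K → A) × Dual A) where
  carrier := {p | ∃ h ∈ polyFun K A, ∀ t, p.1 t = p.2.1 + t • p.2.2 + t • t • h t}
  zero_mem' := ⟨0, zero_mem _, fun t => by simp⟩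
  add_mem' := by
    rintro p q ⟨h, hh, hp⟩ ⟨k, hk, hq⟩
    refine ⟨h + k, add_mem hh hk, fun t => ?_⟩
    simp only [Prod.fst_add, Prod.snd_add, Pi.add_apply, hp, hq, Dual.fst_add, Dual.snd_add,
      smul_add]
    abel
  smul_mem' := by
    rintro c p ⟨h, hh, hp⟩
    refine ⟨c • h, Submodule.smul_mem _ _ hh, fun t => ?_⟩
    simp only [Prod.smul_fst, Prod.smul_snd, Pi.smul_apply, hp, Dual.fst_smul, Dual.snd_smul,
      smul_add, smul_comm c t]
  mul_mem' := by
    rintro p q ⟨h, hh, hp⟩ ⟨k, hk, hq⟩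
    have c (a : A) := const_mem_polyFun (K := K) a
    -- This is the coefficient of t² in (a + tb + t²h)(a' + tb' + t²k), with its higher powers of t
    -- kept inside.
    refine ⟨(fun _ => p.2.1) * k + h * (fun _ => q.2.1) + (fun _ => p.2.2 * q.2.2) +
      (fun t => t • ((fun _ => p.2.2) * k + h * (fun _ => q.2.2) : K → A) t) +
      (fun t => t • t • (h * k) t), ?_, fun t => ?_⟩
    · refine add_mem (add_mem (add_mem (add_mem (mul_mem_polyFun (c _) hk)
        (mul_mem_polyFun hh (c _))) (c _)) (id_smul_mem_polyFun (add_mem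
        (mul_mem_polyFun (c _) hk) (mul_mem_polyFun hh (c _))))) ?_
      exact id_smul_mem_polyFun (id_smul_mem_polyFun (mul_mem_polyFun hh hk))
    · simp only [Prod.fst_mul, Prod.snd_mul, Pi.mul_apply, Pi.add_apply, hp, hq, Dual.fst_mul,
        Dual.snd_mul, smul_add, mul_add, add_mul, smul_mul_assoc, mul_smul_comm]
      abel

/-- Evaluation of functions at a point, as an algebra morphism. -/
def evalHom {T : Type*} (t : T) : (T → A) →ₙₐ[K] A where
  toFun f := f t
  map_smul' _ _ := rfl
  map_zero' := rfl
  map_add' _ _ := rfl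
  map_mul' _ _ := rfl

/-- Over an infinite field the values of a polynomial function determine its jet, so `jets K A`
embeds in a power of `A`. It maps onto A[ε], since t ↦ a + tb has jet a + εb. -/
theorem IsVariety.dual [Infinite K] (hV : IsVariety V) (hA : V (of K A)) :
    V (of K (Dual A)) := by
  have hJ : V (of K (jets K A)) := by
    refine hV.of_separating (fun _ : K => of K A) (fun _ => hA)
      (fun t => (evalHom t).comp
        ((NonUnitalAlgHom.fst K (K → A) (Dual A)).comp
          (NonUnitalSubalgebraClass.subtype (jets K A)))) ?_
    rintro ⟨⟨f, a, b⟩, h, hh, hf⟩ h0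
    replace h0 : ∀ t, f t = 0 := h0
    replace hf : ∀ t, f t = a + t • b + t • t • h t := hf
    have ha : a = 0 := by simpa [h0] using (hf 0).symm
    -- Now t(b + t h(t)) = 0 for all t, so the polynomial function b + t h(t) vanishes at 0.
    have hb : b = 0 := by
      have := polyFun_apply_zero (f := (fun _ => b) + fun t => t • h t)
        (add_mem (const_mem_polyFun b) (id_smul_mem_polyFun hh)) fun t => by
          have := hf t
          rw [h0, ha, zero_add] at this
          simpa using this.symm
      simpa using this
    exact Subtype.ext (Prod.ext (funext h0) (Prod.ext ha hb))
  refine hV.of_surjective hJ ((NonUnitalAlgHom.snd K (K → A) (Dual A)).comp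
    (NonUnitalSubalgebraClass.subtype (jets K A))) fun p => ?_
  exact ⟨⟨(fun t => p.1 + t • p.2, p), 0, zero_mem _, fun t => by simp⟩, rfl⟩

end dualClosure

/-! ### Relatively free algebras -/

/-- The polynomials that vanish identically on every algebra in `V`. -/
def laws (V : ObjectProperty (NonAssocAlgCat K)) (X : Type) :
    Submodule K (FreeNonUnitalNonAssocAlgebra K X) where
  carrier := {p | ∀ A : NonAssocAlgCat K, V A → ∀ x : X → A,
    FreeNonUnitalNonAssocAlgebra.lift K x p = 0}
  zero_mem' A _ x := map_zero _
  add_mem' hp hq A hA x := by rw [map_add, hp A hA, hq A hA, add_zero]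
  smul_mem' c p hp A hA x := by rw [map_smul, hp A hA, smul_zero]

/-- The relatively free algebra of `V` on `X`. -/
def RelFree (V : ObjectProperty (NonAssocAlgCat K)) (X : Type) : Type u :=
  FreeNonUnitalNonAssocAlgebra K X ⧸ laws V X

namespace RelFree

variable {X : Type}

noncomputable instance : AddCommGroup (RelFree V X) :=
  inferInstanceAs (AddCommGroup (FreeNonUnitalNonAssocAlgebra K X ⧸ laws V X))
noncomputable instance : Module K (RelFree V X) :=
  inferInstanceAs (Module K (FreeNonUnitalNonAssocAlgebra K X ⧸ laws V X))

variable (V) in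
/-- The quotient map onto the relatively free algebra. -/
noncomputable def mk : FreeNonUnitalNonAssocAlgebra K X →ₗ[K] RelFree V X := (laws V X).mkQ

theorem mk_surjective : Function.Surjective (mk V (X := X)) := Submodule.mkQ_surjective _

theorem mk_eq_mk {p q : FreeNonUnitalNonAssocAlgebra K X} :
    mk V p = mk V q ↔ ∀ A : NonAssocAlgCat K, V A → ∀ x : X → A,
      FreeNonUnitalNonAssocAlgebra.lift K x p = FreeNonUnitalNonAssocAlgebra.lift K x q := by
  refine (Submodule.Quotient.eq _).trans ?_
  refine forall₃_congr fun A _ x => ?_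
  rw [map_sub, sub_eq_zero]

noncomputable instance : Mul (RelFree V X) :=
  ⟨fun a b => mk V ((mk_surjective a).choose * (mk_surjective b).choose)⟩

/-- The product is defined by chosen representatives; any choice works because classes are compared
by their values in all algebras of `V`. -/
theorem mk_mul (p q : FreeNonUnitalNonAssocAlgebra K X) : mk V (p * q) = mk V p * mk V q := by
  refine mk_eq_mk.2 fun A hA x => ?_
  rw [map_mul, map_mul, mk_eq_mk.1 (mk_surjective (mk V p)).choose_spec A hA,
    mk_eq_mk.1 (mk_surjective (mk V q)).choose_spec A hA]

noncomputable instance : NonUnitalNonAssocRing (RelFree V X) :=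
  { (inferInstance : AddCommGroup (RelFree V X)), (inferInstance : Mul (RelFree V X)) with
    left_distrib := fun a b c => by
      obtain ⟨⟨p, rfl⟩, ⟨q, rfl⟩, ⟨r, rfl⟩⟩ :=
        And.intro (mk_surjective a) (And.intro (mk_surjective b) (mk_surjective c))
      rw [← map_add, ← mk_mul, mul_add, map_add, mk_mul, mk_mul]
    right_distrib := fun a b c => by
      obtain ⟨⟨p, rfl⟩, ⟨q, rfl⟩, ⟨r, rfl⟩⟩ :=
        And.intro (mk_surjective a) (And.intro (mk_surjective b) (mk_surjective c))
      rw [← map_add, ← mk_mul, add_mul, map_add, mk_mul, mk_mul]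
    zero_mul := fun a => by
      obtain ⟨p, rfl⟩ := mk_surjective a
      rw [← map_zero (mk V), ← mk_mul, zero_mul]
    mul_zero := fun a => by
      obtain ⟨p, rfl⟩ := mk_surjective a
      rw [← map_zero (mk V), ← mk_mul, mul_zero] }

instance : IsScalarTower K (RelFree V X) (RelFree V X) := ⟨fun c a b => by
  obtain ⟨⟨p, rfl⟩, q, rfl⟩ := And.intro (mk_surjective a) (mk_surjective b)
  rw [smul_eq_mul, smul_eq_mul, ← map_smul, ← mk_mul, smul_mul_assoc, map_smul, mk_mul]⟩

instance : SMulCommClass K (RelFree V X) (RelFree V X) := ⟨fun c a b => by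
  obtain ⟨⟨p, rfl⟩, q, rfl⟩ := And.intro (mk_surjective a) (mk_surjective b)
  rw [smul_eq_mul, smul_eq_mul, ← map_smul, ← mk_mul, ← mk_mul, mul_smul_comm, map_smul]⟩

variable (V) in
/-- The quotient map onto the relatively free algebra, as an algebra morphism. -/
noncomputable def mkHom : FreeNonUnitalNonAssocAlgebra K X →ₙₐ[K] RelFree V X :=
  { mk V with
    map_zero' := map_zero (mk V)
    map_mul' := mk_mul }

/-- A law evaluated at classes of polynomials is the class of a substitution instance of that law,
which vanishes on every member of `V`. -/
theorem mem (hV : IsVariety V) : V (of K (RelFree V X)) := by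
  obtain ⟨E, hE⟩ := hV
  rw [hE]
  intro φ hφ x
  choose y hy using fun i => mk_surjective (x i)
  rw [show x = fun i => mkHom V (y i) from funext fun i => (hy i).symm, ← map_lift,
    ← map_zero (mkHom V)]
  refine mk_eq_mk.2 fun A hA z => ?_
  rw [map_lift, map_zero]
  exact (hE A).1 hA φ hφ _

variable (V) in
/-- The generators of the relatively free algebra. -/
noncomputable def gen (i : X) : RelFree V X := mkHom V (FreeNonUnitalNonAssocAlgebra.of K i)

/-- The linear map underlying `RelFree.lift`. -/
noncomputable def liftLinear {A : NonAssocAlgCat K} (hA : V A) (x : X → A) :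
    RelFree V X →ₗ[K] A :=
  (laws V X).liftQ
    { toFun := FreeNonUnitalNonAssocAlgebra.lift K x
      map_add' := map_add _
      map_smul' := map_smul _ }
    (fun _ hp => hp A hA x)

/-- The universal property of the relatively free algebra. -/
noncomputable def lift {A : NonAssocAlgCat K} (hA : V A) (x : X → A) : RelFree V X →ₙₐ[K] A :=
  { liftLinear hA x with
    map_zero' := map_zero (liftLinear hA x)
    map_mul' := fun a b => by
      obtain ⟨⟨p, rfl⟩, q, rfl⟩ := And.intro (mk_surjective a) (mk_surjective b)
      rw [← mk_mul]
      exact map_mul (FreeNonUnitalNonAssocAlgebra.lift K x) p q }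

@[simp] theorem lift_gen {A : NonAssocAlgCat K} (hA : V A) (x : X → A) (i : X) :
    lift hA x (gen V i) = x i :=
  FreeNonUnitalNonAssocAlgebra.lift_of_apply K x i

/-- The generators generate the relatively free algebra. -/
theorem adjoin_gen : NonUnitalAlgebra.adjoin K (Set.range (gen V (X := X))) = ⊤ := by
  rw [eq_top_iff]
  intro a _
  set S := NonUnitalAlgebra.adjoin K (Set.range (gen V (X := X)))
  obtain ⟨p, rfl⟩ := mk_surjective a
  let y : X → S := fun i => ⟨gen V i, NonUnitalAlgebra.subset_adjoin K ⟨i, rfl⟩⟩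
  have h : (NonUnitalSubalgebraClass.subtype S).comp (FreeNonUnitalNonAssocAlgebra.lift K y) =
      mkHom V := by
    apply FreeNonUnitalNonAssocAlgebra.hom_ext
    intro i
    simp [y, gen]
  have := DFunLike.congr_fun h p
  change mkHom V p ∈ S
  rw [← this]
  exact (FreeNonUnitalNonAssocAlgebra.lift K y p).2

theorem hom_ext {A : NonAssocAlgCat K} {f g : RelFree V X →ₙₐ[K] A}
    (h : ∀ i, f (gen V i) = g (gen V i)) (a : RelFree V X) : f a = g a := by
  obtain ⟨p, rfl⟩ := mk_surjective a
  have : f.comp (mkHom V) = g.comp (mkHom V) := FreeNonUnitalNonAssocAlgebra.hom_ext K h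
  exact DFunLike.congr_fun this p

end RelFree

end NonAssocAlgCat

namespace NonAssocAlgCat

variable {K : Type u} [Field K] {V : ObjectProperty (NonAssocAlgCat K)}

/-! ### The multilinear part of the relatively free algebra -/

section components

variable {A : Type u} [NonUnitalNonAssocRing A] [Module K A]
  [IsScalarTower K A A] [SMulCommClass K A A]

theorem mul_mem_span_singleton {a b u v : A} (ha : a ∈ Submodule.span K {u})
    (hb : b ∈ Submodule.span K {v}) : a * b ∈ Submodule.span K {u * v} := by
  obtain ⟨⟨c, rfl⟩, d, rfl⟩ :=
    And.intro (Submodule.mem_span_singleton.1 ha) (Submodule.mem_span_singleton.1 hb)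
  rw [smul_mul_assoc, mul_smul_comm]
  exact Submodule.smul_mem _ _ (Submodule.smul_mem _ _ (Submodule.mem_span_singleton_self _))

theorem mul_mem_span_singleton_swap (hA : ∀ u v : A, u * v = -(v * u)) {a b u v : A}
    (ha : a ∈ Submodule.span K {u}) (hb : b ∈ Submodule.span K {v}) :
    a * b ∈ Submodule.span K {v * u} := by
  rw [hA a b]
  exact neg_mem (mul_mem_span_singleton hb ha)

namespace Dual

variable (K A) in
/-- The morphism `A[ε] → A` sending `ε` to `0`. -/
def fstHom : Dual A →ₙₐ[K] A where
  toFun p := p.1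
  map_smul' _ _ := rfl
  map_zero' := rfl
  map_add' _ _ := rfl
  map_mul' _ _ := rfl

end Dual

/-- Elements of `A[ε₁, ε₂, ε₃]`, with `ε₁` outermost, whose components without `ε₂` lie in the
spans of `x`, `z` and `zx`, and whose other components vanish. -/
def firstThirdPart (hA : ∀ u v : A, u * v = -(v * u)) (x z : A) :
    NonUnitalSubalgebra K (Dual (Dual (Dual A))) where
  -- The three projections refer to ε₁, ε₂, ε₃ in turn, `.2` meaning that εᵢ occurs: `c.2.1.2` is
  -- the coefficient of ε₁ε₃.
  carrier := {c | c.1.1.1 = 0 ∧ c.1.2 = 0 ∧ c.2.2 = 0 ∧ c.2.1.1 ∈ Submodule.span K {x} ∧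
    c.1.1.2 ∈ Submodule.span K {z} ∧ c.2.1.2 ∈ Submodule.span K {z * x}}
  zero_mem' := ⟨rfl, rfl, rfl, zero_mem _, zero_mem _, zero_mem _⟩
  add_mem' := by
    rintro c d ⟨c₁, c₂, c₃, c₄, c₅, c₆⟩ ⟨d₁, d₂, d₃, d₄, d₅, d₆⟩
    exact ⟨by simp [c₁, d₁], by simp [c₂, d₂], by simp [c₃, d₃], add_mem c₄ d₄, add_mem c₅ d₅,
      add_mem c₆ d₆⟩
  smul_mem' := by
    rintro k c ⟨c₁, c₂, c₃, c₄, c₅, c₆⟩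
    exact ⟨by simp [c₁], by simp [c₂], by simp [c₃], Submodule.smul_mem _ _ c₄,
      Submodule.smul_mem _ _ c₅, Submodule.smul_mem _ _ c₆⟩
  mul_mem' := by
    rintro c d ⟨c₁, c₂, c₃, c₄, c₅, c₆⟩ ⟨d₁, d₂, d₃, d₄, d₅, d₆⟩
    refine ⟨by simp [c₁], by simp [c₂, d₂], by simp [c₂, d₂, c₃, d₃], by simp [c₁, d₁],
      by simp [c₁, d₁], ?_⟩
    simp only [Dual.fst_mul, Dual.snd_mul, Dual.fst_add, Dual.snd_add, c₁, d₁, zero_mul, mul_zero,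
      zero_add, add_zero]
    exact add_mem (mul_mem_span_singleton c₅ d₄) (mul_mem_span_singleton_swap hA c₄ d₅)

/-- Elements of `A[ε₁, ε₂, ε₃]`, with `ε₁` outermost, whose components without `ε₁` lie in the
spans of `y`, `z` and `yz`, and whose other components vanish. -/
def secondThirdPart (hA : ∀ u v : A, u * v = -(v * u)) (y z : A) :
    NonUnitalSubalgebra K (Dual (Dual (Dual A))) where
  carrier := {c | c.1.1.1 = 0 ∧ c.2 = 0 ∧ c.1.2.1 ∈ Submodule.span K {y} ∧
    c.1.1.2 ∈ Submodule.span K {z} ∧ c.1.2.2 ∈ Submodule.span K {y * z}}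
  zero_mem' := ⟨rfl, rfl, zero_mem _, zero_mem _, zero_mem _⟩
  add_mem' := by
    rintro c d ⟨c₁, c₂, c₄, c₅, c₆⟩ ⟨d₁, d₂, d₄, d₅, d₆⟩
    exact ⟨by simp [c₁, d₁], by simp [c₂, d₂], add_mem c₄ d₄, add_mem c₅ d₅, add_mem c₆ d₆⟩
  smul_mem' := by
    rintro k c ⟨c₁, c₂, c₄, c₅, c₆⟩
    exact ⟨by simp [c₁], by simp [c₂], Submodule.smul_mem _ _ c₄,
      Submodule.smul_mem _ _ c₅, Submodule.smul_mem _ _ c₆⟩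
  mul_mem' := by
    rintro c d ⟨c₁, c₂, c₄, c₅, c₆⟩ ⟨d₁, d₂, d₄, d₅, d₆⟩
    refine ⟨by simp [c₁], by simp [c₂, d₂], by simp [c₁, d₁], by simp [c₁, d₁], ?_⟩
    simp only [Dual.fst_mul, Dual.snd_mul, Dual.snd_add, c₁, d₁, zero_mul, mul_zero,
      zero_add, add_zero]
    exact add_mem (mul_mem_span_singleton_swap hA c₅ d₄) (mul_mem_span_singleton c₄ d₅)

/-- Elements of `A[ε₁, ε₂, ε₃]`, with `ε₁` outermost, without components involving neither `ε₁`
nor `ε₂`, and whose component at `ε₁ε₂ε₃` lies in the span of `y(zx)` and `x(yz)`. -/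
def properPart (hA : ∀ u v : A, u * v = -(v * u)) (x y z : A) :
    NonUnitalSubalgebra K (Dual (Dual (Dual A))) where
  carrier := {c | c.1.1 = 0 ∧ c.2.1.1 ∈ Submodule.span K {x} ∧ c.1.2.1 ∈ Submodule.span K {y} ∧
    c.2.1.2 ∈ Submodule.span K {z * x} ∧ c.1.2.2 ∈ Submodule.span K {y * z} ∧
    c.2.2.2 ∈ Submodule.span K {y * (z * x), x * (y * z)}}
  zero_mem' := ⟨rfl, zero_mem _, zero_mem _, zero_mem _, zero_mem _, zero_mem _⟩
  add_mem' := by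
    rintro c d ⟨c₁, c₂, c₃, c₄, c₅, c₆⟩ ⟨d₁, d₂, d₃, d₄, d₅, d₆⟩
    exact ⟨by simp [c₁, d₁], add_mem c₂ d₂, add_mem c₃ d₃, add_mem c₄ d₄, add_mem c₅ d₅,
      add_mem c₆ d₆⟩
  smul_mem' := by
    rintro k c ⟨c₁, c₂, c₃, c₄, c₅, c₆⟩
    exact ⟨by simp [c₁], Submodule.smul_mem _ _ c₂, Submodule.smul_mem _ _ c₃,
      Submodule.smul_mem _ _ c₄, Submodule.smul_mem _ _ c₅, Submodule.smul_mem _ _ c₆⟩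
  mul_mem' := by
    rintro c d ⟨c₁, c₂, c₃, c₄, c₅, c₆⟩ ⟨d₁, d₂, d₃, d₄, d₅, d₆⟩
    refine ⟨by simp [c₁], by simp [c₁, d₁], by simp [c₁, d₁], by simp [c₁, d₁],
      by simp [c₁, d₁], ?_⟩
    simp only [Dual.snd_mul, Dual.snd_add, c₁, d₁, zero_mul, mul_zero,
      zero_add, add_zero]
    have hl : Submodule.span K {y * (z * x)} ≤
        Submodule.span K {y * (z * x), x * (y * z)} := Submodule.span_mono (by simp)
    have hr : Submodule.span K {x * (y * z)} ≤
        Submodule.span K {y * (z * x), x * (y * z)} := Submodule.span_mono (by simp)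
    -- With no constant term, ε₁ε₂ε₃ arises only from ε₁·ε₂ε₃, ε₂·ε₁ε₃ or ε₃·ε₁ε₂, in either order.
    -- The last is excluded because the ε₃ coefficient is 0, so the ε₁ε₂ coefficient needs no
    -- constraint.
    exact add_mem
      (add_mem (hl (mul_mem_span_singleton c₃ d₄)) (hr (mul_mem_span_singleton_swap hA c₅ d₂)))
      (add_mem (hr (mul_mem_span_singleton c₂ d₅)) (hl (mul_mem_span_singleton_swap hA c₄ d₃)))

theorem scaled_mul_mul_snd (x y z : A) (X Y Z : Dual (Dual (Dual A)))
    (hX : X = ((0, 0), ((x, 0), 0))) (hY : Y = ((0, (y, 0)), 0)) (hZ : Z = (((0, z), 0), 0)) :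
    (Z * (X * Y)).2.2.2 = z * (x * y) := by
  simp only [Dual.snd_mul, Dual.fst_mul, Dual.fst_add, Dual.snd_add]
  subst hX hY hZ
  simp

end components

theorem RelFree.map_mem {X : Type} {A : NonAssocAlgCat K} (h : RelFree V X →ₙₐ[K] A)
    (S : NonUnitalSubalgebra K A) (hS : ∀ i, h (RelFree.gen V i) ∈ S) (a : RelFree V X) :
    h a ∈ S := by
  have ha : a ∈ NonUnitalAlgebra.adjoin K (Set.range (RelFree.gen V (X := X))) :=
    RelFree.adjoin_gen (V := V) (X := X) ▸ NonUnitalAlgebra.mem_top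
  induction ha using NonUnitalAlgebra.adjoin_induction with
  | mem x hx => obtain ⟨i, rfl⟩ := hx; exact hS i
  | add x y _ _ hx hy => rw [map_add]; exact add_mem hx hy
  | zero => rw [map_zero]; exact zero_mem _
  | mul x y _ _ hx hy => rw [map_mul]; exact mul_mem hx hy
  | smul c x _ hx => rw [map_smul]; exact SMulMemClass.smul_mem _ hx

/-! ### The test point F(x, y, z) over F(z) -/

section free

variable (hV : IsVariety V)

/-- The relatively free algebra on `n` generators, as an object of the variety. -/
noncomputable def freeObj (n : ℕ) : V.FullSubcategory :=
  ⟨of K (RelFree V (Fin n)), RelFree.mem hV⟩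

/-- The generators of the relatively free algebra. -/
noncomputable def freeGen {n : ℕ} (i : Fin n) : (freeObj hV n).obj := RelFree.gen V i

/-- The morphism out of a relatively free algebra with given values on generators. -/
noncomputable def freeLift {n : ℕ} {Y : V.FullSubcategory} (x : Fin n → Y.obj) :
    freeObj hV n ⟶ Y :=
  ofFn (X := freeObj hV n) (RelFree.lift Y.2 x)

@[simp] theorem freeLift_gen {n : ℕ} {Y : V.FullSubcategory} (x : Fin n → Y.obj) (i : Fin n) :
    fn (freeLift hV x) (freeGen hV i) = x i :=
  RelFree.lift_gen Y.2 x i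

variable {hV} in
theorem freeObj_hom_ext {n : ℕ} {Y : V.FullSubcategory} {f g : freeObj hV n ⟶ Y}
    (h : ∀ i, fn f (freeGen hV i) = fn g (freeGen hV i)) : f = g :=
  fn_injective (RelFree.hom_ext h)

variable {hV} in
theorem freeObj_map_mem {n : ℕ} {Y : V.FullSubcategory} (f : freeObj hV n ⟶ Y)
    (S : NonUnitalSubalgebra K Y.obj) (hS : ∀ i, fn f (freeGen hV i) ∈ S)
    (a : (freeObj hV n).obj) : fn f a ∈ S :=
  RelFree.map_mem (fn f) S hS a

/-- The free algebra on `t` and `z` as a point over the free algebra on `z`. -/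
noncomputable abbrev freePointTwo : PointOver (freeObj hV 1) where
  pt := freeObj hV 2
  proj := freeLift hV ![0, freeGen hV 0]
  sec := freeLift hV ![freeGen hV 1]
  sec_proj := freeObj_hom_ext <| Fin.forall_fin_one.2 <| by
    rw [fn_comp, freeLift_gen]
    exact freeLift_gen hV _ _

/-- The free algebra on `x`, `y` and `z` as a point over the free algebra on `z`. -/
noncomputable abbrev freePointThree : PointOver (freeObj hV 1) where
  pt := freeObj hV 3
  proj := freeLift hV ![0, 0, freeGen hV 0]
  sec := freeLift hV ![freeGen hV 2]
  sec_proj := freeObj_hom_ext <| Fin.forall_fin_one.2 <| by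
    rw [fn_comp, freeLift_gen]
    exact freeLift_gen hV _ _

/-- The morphism of points sending `t` to the generator `i` of the free algebra on three
generators, where `i` is not the last one. -/
noncomputable abbrev freePointMap (i : Fin 3)
    (hi : (![0, 0, freeGen hV 0] : Fin 3 → (freeObj hV 1).obj) i = 0) :
    freePointTwo hV ⟶ freePointThree hV where
  hom := freeLift hV ![freeGen hV i, freeGen hV 2]
  hom_proj := freeObj_hom_ext <| Fin.forall_fin_two.2 <| by
    constructor
    · rw [fn_comp, freeLift_gen, freeLift_gen]
      exact (freeLift_gen hV _ _).trans hi
    · rw [fn_comp, freeLift_gen, freeLift_gen]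
      exact freeLift_gen hV _ _
  sec_hom := freeObj_hom_ext <| Fin.forall_fin_one.2 <| by
    rw [fn_comp, freeLift_gen, freeLift_gen]
    exact freeLift_gen hV _ _

/-- The morphism of points sending `t` to `x`. -/
noncomputable abbrev freePointFst : freePointTwo hV ⟶ freePointThree hV := freePointMap hV 0 rfl

/-- The morphism of points sending `t` to `y`. -/
noncomputable abbrev freePointSnd : freePointTwo hV ⟶ freePointThree hV := freePointMap hV 1 rfl

theorem jointlyStronglyEpi_freePoint :
    JointlyStronglyEpi (freePointFst hV) (freePointSnd hV) := by
  apply jointlyStronglyEpi_of_jointRange_eq_top hV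
  rw [eq_top_iff]
  intro a _
  refine freeObj_map_mem (𝟙 (freeObj hV 3)) (jointRange (freePointFst hV) (freePointSnd hV)) ?_ a
  intro i
  change freeGen hV i ∈ _
  fin_cases i
  · have := mem_jointRange_left (freePointFst hV) (freePointSnd hV) (freeGen hV 0)
    rwa [freeLift_gen] at this
  · have := mem_jointRange_right (freePointFst hV) (freePointSnd hV) (freeGen hV 0)
    rwa [freeLift_gen] at this
  · have := mem_jointRange_left (freePointFst hV) (freePointSnd hV) (freeGen hV 1)
    rwa [freeLift_gen] at this

variable [Infinite K]

/-- The algebra `F[ε]`, as an object of the variety. -/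
def dualObj (Y : V.FullSubcategory) : V.FullSubcategory := ⟨of K (Dual Y.obj), hV.dual Y.2⟩

/-- The element `εa` of `F[ε]`. -/
def eps {Y : V.FullSubcategory} (a : Y.obj) : (dualObj hV Y).obj :=
  ((0, a) : Y.obj × Y.obj)

/-- The element `a` of `F[ε]`. -/
def dualConst {Y : V.FullSubcategory} (a : Y.obj) : (dualObj hV Y).obj :=
  ((a, 0) : Y.obj × Y.obj)

/-- The morphism `F[ε] → F` sending `ε` to `0`. -/
def dualFst (Y : V.FullSubcategory) : dualObj hV Y ⟶ Y :=
  ofFn (X := dualObj hV Y) (Dual.fstHom K Y.obj)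

/-- The morphism `F(x, y, z) → F(x, y, z)[ε₁, ε₂, ε₃]` scaling the generators. -/
noncomputable def scaleGens :
    freeObj hV 3 ⟶ dualObj hV (dualObj hV (dualObj hV (freeObj hV 3))) :=
  freeLift hV ![eps hV (dualConst hV (dualConst hV (freeGen hV 0))),
    dualConst hV (eps hV (dualConst hV (freeGen hV 1))),
    dualConst hV (dualConst hV (eps hV (freeGen hV 2)))]

/-- Setting ε₁ = ε₂ = 0 kills the images of x and y, so the scaling then factors through F(z). -/
theorem scaleGens_fst_fst :
    scaleGens hV ≫ dualFst hV _ ≫ dualFst hV _ =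
      (freePointThree hV).proj ≫ freeLift hV ![eps hV (freeGen hV 2)] := by
  refine freeObj_hom_ext fun i => ?_
  rw [fn_comp, fn_comp, fn_comp, scaleGens, freeLift_gen, freeLift_gen]
  fin_cases i
  · exact (map_zero (fn (freeLift hV ![eps hV (freeGen hV 2)]))).symm
  · exact (map_zero (fn (freeLift hV ![eps hV (freeGen hV 2)]))).symm
  · exact (freeLift_gen hV ![eps hV (freeGen hV 2)] 0).symm

theorem scaleGens_fst_fst_eq_zero {a : (freeObj hV 3).obj}
    (ha : fn (freePointThree hV).proj a = 0) :
    (fn (scaleGens hV) a).1.1 = (0 : Dual (freeObj hV 3).obj) := by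
  have h := fn_congr (scaleGens_fst_fst hV) a
  rw [fn_comp (freePointThree hV).proj, ha, map_zero] at h
  exact h

/-- The subalgebra of `F(x, y, z)[ε₁, ε₂, ε₃]` that detects the law. -/
noncomputable def properFree (hAlt : V ≤ Alt K) :
    NonUnitalSubalgebra K (dualObj hV (dualObj hV (dualObj hV (freeObj hV 3)))).obj :=
  properPart (mul_eq_neg (hAlt _ (freeObj hV 3).2)) (freeGen hV 0) (freeGen hV 1) (freeGen hV 2)

/-- Elements of F(x, z) produce no ε₂, and lying in the kernel removes the terms free of ε₁ and ε₂.
-/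
theorem scaleGens_freePointFst_mem (hAlt : V ≤ Alt K) (p : (freeObj hV 2).obj)
    (hp : fn (freePointTwo hV).proj p = 0) :
    fn (scaleGens hV) (fn (freePointFst hV).hom p) ∈ properFree hV hAlt := by
  have h₀ : (fn (scaleGens hV) (fn (freePointFst hV).hom p)).1.1 = (0 : Dual (freeObj hV 3).obj) :=
    scaleGens_fst_fst_eq_zero hV ((fn_congr (freePointFst hV).hom_proj p).trans hp)
  obtain ⟨-, h₂, h₃, h₄, -, h₆⟩ := freeObj_map_mem ((freePointFst hV).hom ≫ scaleGens hV)
    (firstThirdPart (mul_eq_neg (hAlt _ (freeObj hV 3).2)) (freeGen hV 0) (freeGen hV 2))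
    (Fin.forall_fin_two.2 ⟨by
      rw [fn_comp, freeLift_gen]
      refine (congrArg (· ∈ _) (freeLift_gen hV _ _)).mpr ?_
      exact ⟨rfl, rfl, rfl, Submodule.mem_span_singleton_self _, zero_mem _, zero_mem _⟩, by
      rw [fn_comp, freeLift_gen]
      refine (congrArg (· ∈ _) (freeLift_gen hV _ _)).mpr ?_
      exact ⟨rfl, rfl, rfl, zero_mem _, Submodule.mem_span_singleton_self _, zero_mem _⟩⟩) p
  refine ⟨h₀, h₄, ?_, h₆, ?_, ?_⟩
  · exact (congrArg Prod.fst h₂ : _ = (0 : (freeObj hV 3).obj)) ▸ zero_mem _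
  · exact (congrArg Prod.snd h₂ : _ = (0 : (freeObj hV 3).obj)) ▸ zero_mem _
  · exact (congrArg Prod.snd h₃ : _ = (0 : (freeObj hV 3).obj)) ▸ zero_mem _

theorem scaleGens_freePointSnd_mem (hAlt : V ≤ Alt K) (p : (freeObj hV 2).obj)
    (hp : fn (freePointTwo hV).proj p = 0) :
    fn (scaleGens hV) (fn (freePointSnd hV).hom p) ∈ properFree hV hAlt := by
  have h₀ : (fn (scaleGens hV) (fn (freePointSnd hV).hom p)).1.1 = (0 : Dual (freeObj hV 3).obj) :=
    scaleGens_fst_fst_eq_zero hV ((fn_congr (freePointSnd hV).hom_proj p).trans hp)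
  obtain ⟨-, h₂, h₃, -, h₅⟩ := freeObj_map_mem ((freePointSnd hV).hom ≫ scaleGens hV)
    (secondThirdPart (mul_eq_neg (hAlt _ (freeObj hV 3).2)) (freeGen hV 1) (freeGen hV 2))
    (Fin.forall_fin_two.2 ⟨by
      rw [fn_comp, freeLift_gen]
      refine (congrArg (· ∈ _) (freeLift_gen hV _ _)).mpr ?_
      exact ⟨rfl, rfl, Submodule.mem_span_singleton_self _, zero_mem _, zero_mem _⟩, by
      rw [fn_comp, freeLift_gen]
      refine (congrArg (· ∈ _) (freeLift_gen hV _ _)).mpr ?_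
      exact ⟨rfl, rfl, zero_mem _, Submodule.mem_span_singleton_self _, zero_mem _⟩⟩) p
  refine ⟨h₀, ?_, h₃, ?_, h₅, ?_⟩
  · exact (congrArg (fun c => c.1.1) h₂ : _ = (0 : (freeObj hV 3).obj)) ▸ zero_mem _
  · exact (congrArg (fun c => c.1.2) h₂ : _ = (0 : (freeObj hV 3).obj)) ▸ zero_mem _
  · exact (congrArg (fun c => c.2.2) h₂ : _ = (0 : (freeObj hV 3).obj)) ▸ zero_mem _

/-- Pulling back along 0 → F(z) turns points into their kernels. By coherence the kernel of F(x, y,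
z) is generated by two kernels whose images are already controlled. -/
theorem scaleGens_mem (hAlt : V ≤ Alt K) (h : AlgebraicallyCoherent V.FullSubcategory)
    {r : (freeObj hV 3).obj} (hr : fn (freePointThree hV).proj r = 0) :
    fn (scaleGens hV) r ∈ properFree hV hAlt := by
  obtain ⟨_, h⟩ := h
  let a : zeroObj hV ⟶ freeObj hV 1 := ofFn (X := zeroObj hV) 0
  have htop : jointRangeChangeOfBase a (freePointFst hV) (freePointSnd hV) = ⊤ :=
    jointRange_eq_top hV (h a _ _ (jointlyStronglyEpi_freePoint hV))
  obtain ⟨w, rfl, -⟩ := pullback_exists (f := (freePointThree hV).proj) (g := a) hV r 0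
    (by rw [hr, map_zero])
  have hw : w ∈ jointRangeChangeOfBase a (freePointFst hV) (freePointSnd hV) :=
    htop ▸ NonUnitalAlgebra.mem_top
  have hker (p : (pullback (freePointTwo hV).proj a).obj) :
      fn (freePointTwo hV).proj (fn (pullback.fst (freePointTwo hV).proj a) p) = 0 :=
    fn_congr pullback.condition p
  let S : NonUnitalSubalgebra K (pullback (freePointThree hV).proj a).obj :=
    (properFree hV hAlt).comap (fn (pullback.fst (freePointThree hV).proj a ≫ scaleGens hV))
  have hle : jointRangeChangeOfBase a (freePointFst hV) (freePointSnd hV) ≤ S := by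
    refine NonUnitalAlgebra.adjoin_le ?_
    rintro _ (⟨p, rfl⟩ | ⟨p, rfl⟩)
    · have := scaleGens_freePointFst_mem hV hAlt _ (hker p)
      exact (congrArg (fun r => fn (scaleGens hV) r ∈ properFree hV hAlt)
        (fst_changeOfBaseFn (f := freePointFst hV) a p)).mpr this
    · have := scaleGens_freePointSnd_mem hV hAlt _ (hker p)
      exact (congrArg (fun r => fn (scaleGens hV) r ∈ properFree hV hAlt)
        (fst_changeOfBaseFn (f := freePointSnd hV) a p)).mpr this
  exact hle hw

/-- The element z(xy) lies in the kernel and scales to ε₁ε₂ε₃·z(xy). Membership in `properFree`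
therefore yields `l` and `m` for the free generators, hence for all substitutions. -/
theorem exists_hasLaw (hV : IsVariety V) (hAlt : V ≤ Alt K)
    (h : AlgebraicallyCoherent V.FullSubcategory) :
    ∃ l m : K, HasLaw V l m := by
  have hr : fn (freePointThree hV).proj (freeGen hV 2 * (freeGen hV 0 * freeGen hV 1)) = 0 := by
    rw [map_mul, map_mul, freeLift_gen, freeLift_gen]
    change _ * (0 * _) = _
    rw [zero_mul, mul_zero]
  obtain ⟨-, -, -, -, -, h₆⟩ := scaleGens_mem hV hAlt h hr
  obtain ⟨l, m, hlm⟩ := Submodule.mem_span_pair.1 h₆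
  set x : (freeObj hV 3).obj := freeGen hV 0
  set y : (freeObj hV 3).obj := freeGen hV 1
  set z : (freeObj hV 3).obj := freeGen hV 2
  have key : z * (x * y) = l • (y * (z * x)) + m • (x * (y * z)) := by
    rw [hlm, map_mul, map_mul]
    exact (scaled_mul_mul_snd x y z _ _ _ (freeLift_gen hV _ _) (freeLift_gen hV _ _)
      (freeLift_gen hV _ _)).symm
  refine ⟨l, m, fun A hA a b c => ?_⟩
  let φ : freeObj hV 3 ⟶ ⟨A, hA⟩ := freeLift hV ![a, b, c]
  have ha : fn φ x = a := freeLift_gen hV _ _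
  have hb : fn φ y = b := freeLift_gen hV _ _
  have hc : fn φ z = c := freeLift_gen hV _ _
  have h := congrArg (fn φ) key
  simp only [map_mul, map_add, map_smul, ha, hb, hc] at h
  exact h

end free

end NonAssocAlgCat

theorem theorem2p5 (K : Type u) [Field K] [Infinite K]
    (V : ObjectProperty (NonAssocAlgCat K))
    (hV : NonAssocAlgCat.IsSubvariety V (NonAssocAlgCat.Alt K)) :
    AlgebraicallyCoherent V.FullSubcategory ↔
      NonAssocAlgCat.IsSubvariety V (NonAssocAlgCat.AAAlg K) ∨
        NonAssocAlgCat.IsSubvariety V (NonAssocAlgCat.Lie K) := by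
  obtain ⟨hV, hAlt⟩ := hV
  constructor
  · intro h
    obtain ⟨l, m, hlaw⟩ := NonAssocAlgCat.exists_hasLaw hV hAlt h
    exact (hlaw.le_AAAlg_or_le_Lie hAlt).imp (And.intro hV) (And.intro hV)
  · rintro (⟨-, h⟩ | ⟨-, h⟩)
    · exact (NonAssocAlgCat.hasLaw_of_le_AAAlg hAlt h).algebraicallyCoherent hV hAlt
    · exact (NonAssocAlgCat.hasLaw_of_le_Lie h).algebraicallyCoherent hV hAlt
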